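/- Let $\xi\ge 0$ be a constant and let $ef:(-\infty,0)\to\mathbb{R}$ be a real, twice differentiable solution of \[ \frac{\mathrm d^2}{\mathrm d\tau^2}ef(\tau)+2\,(ef(\tau))^3-\frac{2\xi}{-\tau}\,(ef(\tau))^2=0,\qquad \tau<0 . \] Define $\omega_{ef}(\tau)=\bigl((ef'(\tau))^2+(ef(\tau))^4\bigr)^{1/4}$. Let $\mathrm{sn}(u)=\sin(\mathrm{am}(u))$ be the Jacobi function with elliptic parameter $m=-1$, where $\mathrm{am}$ is the inverse of $\varphi\mapsto F(\varphi)=\int_0^\varphi(1+\sin^2\theta)^{-1/2}\,\mathrm d\theta$, and let $K=F(\pi/2)$. Then the limit $\omega=\lim_{\tau\to-\infty}\omega_{ef}(\tau)$ exists and is finite, and it is the unique real number $\omega\ge 0$ for which there is a $u_0\in[0,4K)$ with \[ ef(\tau)=\omega\,\mathrm{sn}(\omega\tau+u_0)+\mathcal{O}\!\left(\frac{\xi+\xi^2}{-\tau}\right)\qquad(\tau\to-\infty). \] Furthermore the solution is oscillatory, i.e. $\omega>0$, if there is a time $\tau_1<0$ such that either - $0\le\xi<2$ and $\omega_{ef}(\tau_1)>0$,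 or - $\omega_{ef}(\tau_1)>\tfrac43\,\xi/(-\tau_1)$. -/

import Mathlib

open Filter Topology Set

noncomputable section

/-- Incomplete elliptic integral of the first kind `F(φ | m)`, with elliptic parameter `m`. -/
def ellipticF (φ m : ℝ) : ℝ := ∫ θ in (0 : ℝ)..φ, 1 / √(1 - m * Real.sin θ ^ 2)

/-- Complete elliptic integral of the first kind `K(m)`. -/
def ellipticK (m : ℝ) : ℝ := ellipticF (Real.pi / 2) m

/-- Jacobi amplitude `am(u | m)`: the inverse of `φ ↦ F(φ | m)`. It is used only for `m = -1`,
where `φ ↦ F(φ | m)` is a bijection of `ℝ` (see `ellipticF_neg_one_bijective`). -/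
def jacobiAm (u m : ℝ) : ℝ := Function.invFun (fun φ => ellipticF φ m) u

/-- The Jacobi function `sn(u) = sn(u | -1)`. -/
def jacobiSn (u : ℝ) : ℝ := Real.sin (jacobiAm u (-1))

/-- `ef` is a (real, classical) solution on `(-∞, 0)` of
`ef'' + 2 ef ^ 3 - (2 ξ / (-τ)) ef ^ 2 = 0`. -/
def IsBackgroundSolution (ξ : ℝ) (ef : ℝ → ℝ) : Prop :=
  ∀ τ < 0, DifferentiableAt ℝ ef τ ∧ DifferentiableAt ℝ (deriv ef) τ ∧
    deriv (deriv ef) τ + 2 * ef τ ^ 3 - 2 * ξ / (-τ) * ef τ ^ 2 = 0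

/-- `ω_ef(τ) = ((ef'(τ))² + ef(τ)⁴)^{1/4}`. -/
def omegaFn (ef : ℝ → ℝ) (τ : ℝ) : ℝ := (deriv ef τ ^ 2 + ef τ ^ 4) ^ (1 / 4 : ℝ)

/-- `ω ≥ 0` and `u₀ ∈ [0, 4K(-1))` are constants with
`ef(τ) = ω sn(ω τ + u₀) + O((ξ + ξ²) / (-τ))` as `τ → -∞`. -/
def HasOscillatoryForm (ξ : ℝ) (ef : ℝ → ℝ) (ω u₀ : ℝ) : Prop :=
  0 ≤ ω ∧ u₀ ∈ Ico 0 (4 * ellipticK (-1)) ∧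
    (fun τ => ef τ - ω * jacobiSn (ω * τ + u₀)) =O[atBot] (fun τ => (ξ + ξ ^ 2) / (-τ))

theorem ellipticF_neg_one_integrand_continuous :
    Continuous fun θ : ℝ => 1 / √(1 - (-1) * Real.sin θ ^ 2) := by
  refine continuous_const.div (by fun_prop) fun θ => ?_
  have : 0 < 1 - (-1) * Real.sin θ ^ 2 := by nlinarith [sq_nonneg (Real.sin θ)]
  exact (Real.sqrt_pos.2 this).ne'

theorem ellipticF_neg_one_sub_ge {a b : ℝ} (hab : a ≤ b) :
    (b - a) / 2 ≤ ellipticF b (-1) - ellipticF a (-1) := by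
  have hc := ellipticF_neg_one_integrand_continuous
  have h1 : ellipticF b (-1) - ellipticF a (-1)
      = ∫ θ in a..b, 1 / √(1 - (-1) * Real.sin θ ^ 2) :=
    intervalIntegral.integral_interval_sub_left (hc.intervalIntegrable _ _)
      (hc.intervalIntegrable _ _)
  have h2 : (b - a) / 2 = ∫ _θ in a..b, (1 / 2 : ℝ) := by
    rw [intervalIntegral.integral_const, smul_eq_mul]; ring
  rw [h1, h2]
  refine intervalIntegral.integral_mono_on hab (by simp) (hc.intervalIntegrable _ _)
    fun θ _ => ?_
  have hp : 0 < 1 - (-1) * Real.sin θ ^ 2 := by nlinarith [sq_nonneg (Real.sin θ)]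
  refine one_div_le_one_div_of_le (Real.sqrt_pos.2 hp) ?_
  rw [Real.sqrt_le_left (by norm_num)]
  nlinarith [Real.sin_sq_le_one θ]

theorem ellipticF_neg_one_bijective : Function.Bijective fun φ => ellipticF φ (-1) := by
  have hm : StrictMono fun φ => ellipticF φ (-1) := fun a b hab => by
    have := ellipticF_neg_one_sub_ge hab.le
    simp only
    linarith
  refine ⟨hm.injective, Continuous.surjective ?_ ?_ ?_⟩
  · exact intervalIntegral.continuous_primitive
      (fun a b => ellipticF_neg_one_integrand_continuous.intervalIntegrable a b) 0
  · have h0 : ellipticF 0 (-1) = 0 := by simp [ellipticF]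
    refine tendsto_atTop_mono' _ ?_ (tendsto_id.atTop_div_const (by norm_num : (0 : ℝ) < 2))
    filter_upwards [eventually_ge_atTop (0 : ℝ)] with x hx
    have := ellipticF_neg_one_sub_ge hx
    simp only [id]
    linarith
  · have h0 : ellipticF 0 (-1) = 0 := by simp [ellipticF]
    refine tendsto_atBot_mono' _ ?_ (tendsto_id.atBot_div_const (by norm_num : (0 : ℝ) < 2))
    filter_upwards [eventually_le_atBot (0 : ℝ)] with x hx
    have := ellipticF_neg_one_sub_ge hx
    simp only [id]
    linarith

end

open Asymptotics

/-! The energy `E = ef' ^ 2 + ef ^ 4` has derivative of size `ξ / (-τ)`, which is not integrable at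
`-∞`. Subtracting `4/3 ξ ef ^ 3 / (-τ)` gives `H = modEnergy`, with `H' = -4/3 ξ ef ^ 3 / τ ^ 2`. A
Gronwall argument bounds `E`, so `H` and `E` share a limit `ω ^ 4`.

If `ω = 0`, a self-bounding estimate gives `omegaFn ef ≤ 8/3 ξ / (-τ)`, which is the claimed form.
If `ω > 0`, write `r = omegaFn ef` and `ef = r sn θ`. Then `θ' - ω` equals `-2/3 ξ ef ^ 3 / (ω ^ 3
(-τ))` to leading order. Since `2 ef ^ 3` is `-ef''` up to `O(1 / (-τ))`, this term is a total
derivative up to integrable errors, so `θ - ω τ` converges (`exists_phase_shift`). Uniqueness of `ω`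
follows by sampling where `sn = 1`.

For positivity, the decay forced by `ω = 0` is contradicted by the monotonicity of `τ H`, or for `ξ
< 2` by the logarithmic growth of `τ ^ 4 E`. -/

/-! ### Period, bounds and Lipschitz estimate for `sn` -/

theorem jacobiAm_ellipticF (φ : ℝ) : jacobiAm (ellipticF φ (-1)) (-1) = φ :=
  Function.leftInverse_invFun ellipticF_neg_one_bijective.injective φ

theorem ellipticF_jacobiAm (u : ℝ) : ellipticF (jacobiAm u (-1)) (-1) = u :=
  Function.rightInverse_invFun ellipticF_neg_one_bijective.surjective u

theorem jacobiSn_ellipticF (φ : ℝ) : jacobiSn (ellipticF φ (-1)) = Real.sin φ := by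
  rw [jacobiSn, jacobiAm_ellipticF]

theorem hasDerivAt_ellipticF_neg_one (φ : ℝ) :
    HasDerivAt (fun φ => ellipticF φ (-1)) (1 / √(1 - (-1) * Real.sin φ ^ 2)) φ :=
  (ellipticF_neg_one_integrand_continuous.integral_hasStrictDerivAt 0 φ).hasDerivAt

theorem ellipticK_neg_one_pos : 0 < ellipticK (-1) := by
  have h := ellipticF_neg_one_sub_ge (a := 0) (b := Real.pi / 2) (by positivity)
  have h0 : ellipticF 0 (-1) = 0 := by simp [ellipticF]
  have := Real.pi_pos
  rw [ellipticK]
  linarith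

theorem ellipticF_neg_one_add_pi (φ : ℝ) :
    ellipticF (φ + Real.pi) (-1) = ellipticF φ (-1) + ellipticF Real.pi (-1) := by
  have hc := ellipticF_neg_one_integrand_continuous
  have hper : Function.Periodic (fun θ : ℝ => 1 / √(1 - (-1) * Real.sin θ ^ 2)) Real.pi := by
    intro θ
    simp [Real.sin_add_pi]
  have h1 := hper.intervalIntegral_add_eq φ 0
  have h2 := intervalIntegral.integral_add_adjacent_intervals
    (hc.intervalIntegrable (μ := MeasureTheory.volume) 0 φ)
    (hc.intervalIntegrable φ (φ + Real.pi))
  rw [zero_add] at h1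
  simp only [ellipticF]
  rw [← h2, h1]

theorem ellipticF_neg_one_neg (φ : ℝ) : ellipticF (-φ) (-1) = -ellipticF φ (-1) := by
  have h := intervalIntegral.integral_comp_neg (a := 0) (b := φ)
    (fun θ : ℝ => 1 / √(1 - (-1) * Real.sin θ ^ 2))
  simp only [Real.sin_neg, neg_zero, even_two.neg_pow] at h
  simp only [ellipticF]
  rw [h, intervalIntegral.integral_symm]

theorem ellipticF_neg_one_pi : ellipticF Real.pi (-1) = 2 * ellipticK (-1) := by
  have h := ellipticF_neg_one_add_pi (-(Real.pi / 2))
  rw [ellipticF_neg_one_neg, show -(Real.pi / 2) + Real.pi = Real.pi / 2 by ring] at h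
  rw [ellipticK]
  linarith

theorem jacobiSn_periodic : Function.Periodic jacobiSn (4 * ellipticK (-1)) := by
  intro u
  have h : ellipticF (jacobiAm u (-1) + Real.pi + Real.pi) (-1) = u + 4 * ellipticK (-1) := by
    rw [ellipticF_neg_one_add_pi, ellipticF_neg_one_add_pi, ellipticF_neg_one_pi,
      ellipticF_jacobiAm]
    ring
  rw [← h, jacobiSn_ellipticF, Real.sin_add_pi, Real.sin_add_pi, neg_neg, jacobiSn]

theorem jacobiSn_ellipticK : jacobiSn (ellipticK (-1)) = 1 := by
  rw [ellipticK, jacobiSn_ellipticF, Real.sin_pi_div_two]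

theorem abs_jacobiSn_le_one (u : ℝ) : |jacobiSn u| ≤ 1 := Real.abs_sin_le_one _

theorem abs_sub_le_two_mul_abs_ellipticF_sub (a b : ℝ) :
    |a - b| ≤ 2 * |ellipticF a (-1) - ellipticF b (-1)| := by
  rcases le_total b a with h | h
  · have h1 := ellipticF_neg_one_sub_ge h
    rw [abs_of_nonneg (sub_nonneg.2 h)]
    linarith [le_abs_self (ellipticF a (-1) - ellipticF b (-1))]
  · have h1 := ellipticF_neg_one_sub_ge h
    rw [abs_of_nonpos (sub_nonpos.2 h)]
    linarith [neg_abs_le (ellipticF a (-1) - ellipticF b (-1))]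

theorem abs_jacobiSn_sub_le (u v : ℝ) : |jacobiSn u - jacobiSn v| ≤ 2 * |u - v| := by
  have h := abs_sub_le_two_mul_abs_ellipticF_sub (jacobiAm u (-1)) (jacobiAm v (-1))
  rw [ellipticF_jacobiAm, ellipticF_jacobiAm] at h
  exact (Real.abs_sin_sub_sin_le _ _).trans h

/-! ### Phase functions for planar flows -/

theorem eq_of_hasDerivAt_zero_Iic {D : ℝ → ℝ} {T : ℝ} (hD : ∀ τ ≤ T, HasDerivAt D 0 τ)
    {τ : ℝ} (hτ : τ ≤ T) : D τ = D T := by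
  have h := (convex_Iic T).norm_image_sub_le_of_norm_hasDerivWithin_le (f := D) (f' := fun _ => 0)
    (C := 0) (fun x hx => (hD x hx).hasDerivWithinAt) (by simp) hτ (mem_Iic.2 le_rfl)
  rw [zero_mul, norm_le_zero_iff, sub_eq_zero] at h
  exact h.symm

theorem exists_hasDerivAt_Iic {k : ℝ → ℝ} {T : ℝ} (hk : ContinuousOn k (Iic T)) (c : ℝ) :
    ∃ ψ : ℝ → ℝ, ψ T = c ∧ ∀ τ ≤ T, HasDerivAt ψ (k τ) τ := by
  have hc : Continuous fun s => k (min s T) :=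
    hk.comp_continuous (by fun_prop) fun s => min_le_right s T
  refine ⟨fun τ => c + ∫ s in T..τ, k (min s T), by simp, fun τ hτ => ?_⟩
  have h := ((hc.integral_hasStrictDerivAt T τ).hasDerivAt).const_add c
  simpa [min_eq_left hτ] using h

/-- A point moving on a circle with angular velocity `k` is `(sin ψ, cos ψ)` with `ψ' = k`. -/
theorem exists_angle {x z k : ℝ → ℝ} {T : ℝ} (hk : ContinuousOn k (Iic T))
    (hx : ∀ τ ≤ T, HasDerivAt x (k τ * z τ) τ) (hz : ∀ τ ≤ T, HasDerivAt z (-(k τ * x τ)) τ)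
    (h1 : x T ^ 2 + z T ^ 2 = 1) :
    ∃ ψ : ℝ → ℝ, ∀ τ ≤ T, HasDerivAt ψ (k τ) τ ∧ x τ = Real.sin (ψ τ) := by
  obtain ⟨c, hcx, hcz⟩ : ∃ c, Real.sin c = x T ∧ Real.cos c = z T := by
    have hn : ‖(⟨z T, x T⟩ : ℂ)‖ = 1 := by
      rw [Complex.norm_eq_sqrt_sq_add_sq, Real.sqrt_eq_one]
      simpa [add_comm] using h1
    refine ⟨Complex.arg ⟨z T, x T⟩, ?_, ?_⟩
    · rw [Complex.sin_arg, hn, div_one]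
    · rw [Complex.cos_arg (norm_pos_iff.1 (by rw [hn]; norm_num)), hn, div_one]
  obtain ⟨ψ, hψT, hψ⟩ := exists_hasDerivAt_Iic hk c
  refine ⟨ψ, fun τ hτ => ⟨hψ τ hτ, ?_⟩⟩
  -- Both points rotate with the same velocity, so their squared distance is constant; it vanishes
  -- at `T`.
  have hD : ∀ s ≤ T, HasDerivAt
      (fun s => (x s - Real.sin (ψ s)) ^ 2 + (z s - Real.cos (ψ s)) ^ 2) 0 s := fun s hs => by
    refine ((((hx s hs).sub (hψ s hs).sin).pow 2).add
      (((hz s hs).sub (hψ s hs).cos).pow 2)).congr_deriv ?_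
    simp only [Pi.sub_apply]
    ring
  have h := eq_of_hasDerivAt_zero_Iic hD hτ
  simp only [hψT, hcx, hcz] at h
  nlinarith [sq_nonneg (x τ - Real.sin (ψ τ)), sq_nonneg (z τ - Real.cos (ψ τ))]

/-- A point moving with speed `g` on the curve `x ^ 4 + y ^ 2 = 1` along the flow
`x' = y`, `y' = -2 x ^ 3` has `x = sn θ` with `θ' = g`. -/
theorem exists_jacobiSn_phase {x y g : ℝ → ℝ} {T : ℝ} (hg : ContinuousOn g (Iic T))
    (hx : ∀ τ ≤ T, HasDerivAt x (g τ * y τ) τ)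
    (hy : ∀ τ ≤ T, HasDerivAt y (-(2 * g τ * x τ ^ 3)) τ)
    (h1 : ∀ τ ≤ T, x τ ^ 4 + y τ ^ 2 = 1) :
    ∃ θ : ℝ → ℝ, ∀ τ ≤ T, HasDerivAt θ (g τ) τ ∧ x τ = jacobiSn (θ τ) := by
  have hp : ∀ τ, 0 < √(1 + x τ ^ 2) := fun τ => Real.sqrt_pos.2 (by positivity)
  have hp2 : ∀ τ, √(1 + x τ ^ 2) ^ 2 = 1 + x τ ^ 2 := fun τ => Real.sq_sqrt (by positivity)
  have hk : ContinuousOn (fun τ => g τ * √(1 + x τ ^ 2)) (Iic T) := by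
    have hxc : ContinuousOn x (Iic T) := fun τ hτ => (hx τ hτ).continuousAt.continuousWithinAt
    exact hg.mul (by fun_prop)
  -- Since `y ^ 2 = (1 - x ^ 2) (1 + x ^ 2)`, dividing `y` by `√(1 + x ^ 2)` moves the point to the
  -- unit circle, at the cost of the same factor in the angular velocity. Composing with `ellipticF`
  -- removes that factor again.
  obtain ⟨ψ, hψ⟩ := exists_angle (x := x) (z := fun τ => y τ / √(1 + x τ ^ 2)) hk
    (fun τ hτ => by
      refine (hx τ hτ).congr_deriv ?_
      have := (hp τ).ne'
      field_simp)
    (fun τ hτ => by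
      have hq : HasDerivAt (fun τ => √(1 + x τ ^ 2))
          ((2 * x τ * (g τ * y τ)) / (2 * √(1 + x τ ^ 2))) τ := by
        refine HasDerivAt.sqrt ?_ (by positivity)
        refine (((hx τ hτ).pow 2).const_add 1).congr_deriv ?_
        simp
      refine ((hy τ hτ).div hq (hp τ).ne').congr_deriv ?_
      have h0 := (hp τ).ne'
      have h2 := hp2 τ
      have h3 := h1 τ hτ
      generalize √(1 + x τ ^ 2) = p at *
      field_simp
      have h4 : y τ ^ 2 = (1 - x τ ^ 2) * p ^ 2 := by rw [h2]; linarith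
      have h5 : x τ ^ 2 = p ^ 2 - 1 := by linarith
      rw [h4, h5]
      ring_nf)
    (by
      have h2 := hp2 T
      have h3 := h1 T le_rfl
      have h0 := (hp T).ne'
      simp only [div_pow, h2]
      field_simp
      linarith)
  refine ⟨fun τ => ellipticF (ψ τ) (-1), fun τ hτ => ⟨?_, ?_⟩⟩
  · have h := (hasDerivAt_ellipticF_neg_one (ψ τ)).comp τ (hψ τ hτ).1
    refine h.congr_deriv ?_
    rw [← (hψ τ hτ).2, show 1 - (-1) * x τ ^ 2 = 1 + x τ ^ 2 by ring]
    have := (hp τ).ne'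
    field_simp
  · rw [jacobiSn_ellipticF]
    exact (hψ τ hτ).2

/-! ### Uniqueness of the amplitude -/

/-- Along times `s n → -∞` at which the second profile equals its maximum `ω'`, the first is at most
`ω`, while their difference tends to `0`. -/
theorem le_of_tendsto_sub_jacobiSn {f : ℝ → ℝ} {ω ω' u u' : ℝ} (hω : 0 ≤ ω) (hω' : 0 ≤ ω')
    (h : Tendsto (fun τ => f τ - ω * jacobiSn (ω * τ + u)) atBot (𝓝 0))
    (h' : Tendsto (fun τ => f τ - ω' * jacobiSn (ω' * τ + u')) atBot (𝓝 0)) : ω' ≤ ω := by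
  rcases hω'.eq_or_lt with rfl | hpos
  · exact hω
  have hK := ellipticK_neg_one_pos
  let s : ℕ → ℝ := fun n => (ellipticK (-1) - n * (4 * ellipticK (-1)) - u') / ω'
  have hs : Tendsto s atTop atBot := by
    refine Tendsto.atBot_div_const hpos ?_
    refine tendsto_atBot_add_const_right _ _ ?_
    refine tendsto_atBot_add_const_left _ _ ?_
    exact tendsto_neg_atTop_atBot.comp
      (tendsto_natCast_atTop_atTop.atTop_mul_const (by positivity))
  have hval : ∀ n, jacobiSn (ω' * s n + u') = 1 := fun n => by
    rw [show ω' * s n + u' = ellipticK (-1) - n * (4 * ellipticK (-1)) by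
      simp only [s]; field_simp; ring, jacobiSn_periodic.sub_nat_mul_eq, jacobiSn_ellipticK]
  have hlim := ((h.sub h').comp hs)
  rw [sub_zero] at hlim
  refine sub_nonpos.1 (ge_of_tendsto hlim (Eventually.of_forall fun n => ?_))
  simp only [Function.comp, hval]
  nlinarith [(abs_le.1 (abs_jacobiSn_le_one (ω * s n + u))).2]

/-! ### Limits at `-∞` from derivative bounds -/

theorem monotoneOn_Iic_of_hasDerivAt_nonneg {f f' : ℝ → ℝ} {T : ℝ}
    (hf : ∀ τ ≤ T, HasDerivAt f (f' τ) τ) (h0 : ∀ τ ≤ T, 0 ≤ f' τ) : MonotoneOn f (Iic T) :=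
  monotoneOn_of_hasDerivWithinAt_nonneg (f' := f') (convex_Iic T)
    (fun τ hτ => (hf τ hτ).continuousAt.continuousWithinAt)
    (fun τ hτ => (hf τ (mem_Iic.1 (interior_subset hτ))).hasDerivWithinAt)
    (fun τ hτ => h0 τ (mem_Iic.1 (interior_subset hτ)))

/-- Both `φ + G` and `φ - G` are monotone, which gives the limit and the tail bound without
requiring `G'` to be integrable. -/
theorem exists_tendsto_of_abs_deriv_le {G G' φ φ' : ℝ → ℝ} {T : ℝ}
    (hG : ∀ τ ≤ T, HasDerivAt G (G' τ) τ) (hφ : ∀ τ ≤ T, HasDerivAt φ (φ' τ) τ)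
    (hb : ∀ τ ≤ T, |G' τ| ≤ φ' τ) (h0 : Tendsto φ atBot (𝓝 0)) :
    ∃ L, Tendsto G atBot (𝓝 L) ∧ ∀ τ ≤ T, |G τ - L| ≤ φ τ := by
  have hmφ : MonotoneOn φ (Iic T) := monotoneOn_Iic_of_hasDerivAt_nonneg hφ
    fun τ hτ => (abs_nonneg _).trans (hb τ hτ)
  have hp : MonotoneOn (fun τ => φ τ + G τ) (Iic T) := monotoneOn_Iic_of_hasDerivAt_nonneg
    (fun τ hτ => (hφ τ hτ).add (hG τ hτ)) fun τ hτ => by linarith [(abs_le.1 (hb τ hτ)).1]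
  have hm : MonotoneOn (fun τ => φ τ - G τ) (Iic T) := monotoneOn_Iic_of_hasDerivAt_nonneg
    (fun τ hτ => (hφ τ hτ).sub (hG τ hτ)) fun τ hτ => by linarith [(abs_le.1 (hb τ hτ)).2]
  have hφ0 : ∀ τ ≤ T, 0 ≤ φ τ := fun τ hτ => by
    refine le_of_tendsto h0 ?_
    filter_upwards [eventually_le_atBot τ] with s hs
    exact hmφ (hs.trans hτ) hτ hs
  have hmono : Monotone fun τ => φ (min τ T) + G (min τ T) := fun a b hab =>
    hp (mem_Iic.2 (min_le_right _ _)) (mem_Iic.2 (min_le_right _ _)) (min_le_min_right T hab)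
  have hbdd : BddBelow (range fun τ => φ (min τ T) + G (min τ T)) := by
    refine ⟨G T - φ T, ?_⟩
    rintro _ ⟨τ, rfl⟩
    have h1 := hm (min_le_right τ T) (mem_Iic.2 le_rfl) (min_le_right τ T)
    have h2 := hφ0 _ (min_le_right τ T)
    simp only at h1 ⊢
    linarith
  have hlim := tendsto_atBot_ciInf hmono hbdd
  set L := ⨅ τ, (φ (min τ T) + G (min τ T))
  have hGL : Tendsto G atBot (𝓝 L) := by
    have h := hlim.sub h0
    rw [sub_zero] at h
    refine h.congr' ?_
    filter_upwards [eventually_le_atBot T] with τ hτ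
    rw [min_eq_left hτ]
    ring
  refine ⟨L, hGL, fun τ hτ => abs_le.2 ⟨?_, ?_⟩⟩
  · have h : L ≤ φ τ + G τ := by
      refine le_of_tendsto (by simpa using h0.add hGL) ?_
      filter_upwards [eventually_le_atBot τ] with s hs
      exact hp (hs.trans hτ) hτ hs
    linarith
  · have h : -L ≤ φ τ - G τ := by
      refine le_of_tendsto (by simpa using h0.sub hGL) ?_
      filter_upwards [eventually_le_atBot τ] with s hs
      exact hm (hs.trans hτ) hτ hs
    linarith

theorem tendsto_const_div_neg_atBot (A : ℝ) :
    Tendsto (fun τ : ℝ => A / (-τ)) atBot (𝓝 0) :=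
  tendsto_neg_atBot_atTop.const_div_atTop A

theorem hasDerivAt_const_div_neg (A : ℝ) {τ : ℝ} (hτ : τ < 0) :
    HasDerivAt (fun τ : ℝ => A / (-τ)) (A / τ ^ 2) τ := by
  refine ((hasDerivAt_const τ A).div (hasDerivAt_id τ).neg (by simpa using hτ.ne)).congr_deriv ?_
  simp

theorem hasDerivAt_const_div_sq (A : ℝ) {τ : ℝ} (hτ : τ < 0) :
    HasDerivAt (fun τ : ℝ => A / τ ^ 2) (2 * A / (-τ) ^ 3) τ := by
  refine ((hasDerivAt_const τ A).div ((hasDerivAt_id τ).pow 2)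
    (by simpa using hτ.ne)).congr_deriv ?_
  have := hτ.ne
  simp
  field_simp

theorem exists_isBigO_of_deriv_isBigO_sq {G G' : ℝ → ℝ} {κ : ℝ}
    (hG : ∀ᶠ τ in atBot, HasDerivAt G (G' τ) τ)
    (hO : G' =O[atBot] fun τ => κ / τ ^ 2) :
    ∃ L, Tendsto G atBot (𝓝 L) ∧ (fun τ => G τ - L) =O[atBot] fun τ => κ / (-τ) := by
  obtain ⟨C, hC⟩ := hO.bound
  obtain ⟨T, hT⟩ := eventually_atBot.1 (hG.and (hC.and (eventually_lt_atBot 0)))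
  obtain ⟨L, hL, hb⟩ := exists_tendsto_of_abs_deriv_le (T := T) (fun τ hτ => (hT τ hτ).1)
    (fun τ hτ => hasDerivAt_const_div_neg (C * |κ|) (hT τ hτ).2.2)
    (fun τ hτ => by
      have h := (hT τ hτ).2.1
      rwa [Real.norm_eq_abs, Real.norm_eq_abs, abs_div, abs_of_nonneg (sq_nonneg τ),
        ← mul_div_assoc] at h)
    (tendsto_const_div_neg_atBot _)
  refine ⟨L, hL, IsBigO.of_bound C ?_⟩
  filter_upwards [eventually_le_atBot T] with τ hτ
  rw [Real.norm_eq_abs, Real.norm_eq_abs, abs_div, abs_of_pos (neg_pos.2 (hT τ hτ).2.2),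
    ← mul_div_assoc]
  exact hb τ hτ

theorem exists_isBigO_of_deriv_isBigO_cube {G G' : ℝ → ℝ} {κ : ℝ}
    (hG : ∀ᶠ τ in atBot, HasDerivAt G (G' τ) τ)
    (hO : G' =O[atBot] fun τ => κ / (-τ) ^ 3) :
    ∃ L, Tendsto G atBot (𝓝 L) ∧ (fun τ => G τ - L) =O[atBot] fun τ => κ / τ ^ 2 := by
  obtain ⟨C, hC⟩ := hO.bound
  obtain ⟨T, hT⟩ := eventually_atBot.1 (hG.and (hC.and (eventually_lt_atBot 0)))
  have h0 : Tendsto (fun τ : ℝ => C * |κ| / 2 / τ ^ 2) atBot (𝓝 0) :=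
    (((tendsto_pow_atTop two_ne_zero).comp
      tendsto_neg_atBot_atTop).const_div_atTop (C * |κ| / 2)).congr fun τ => by simp
  obtain ⟨L, hL, hb⟩ := exists_tendsto_of_abs_deriv_le (T := T) (fun τ hτ => (hT τ hτ).1)
    (fun τ hτ => hasDerivAt_const_div_sq (C * |κ| / 2) (hT τ hτ).2.2)
    (fun τ hτ => by
      have h := (hT τ hτ).2.1
      have h3 : 0 ≤ (-τ) ^ 3 := pow_nonneg (neg_nonneg.2 (hT τ hτ).2.2.le) 3
      rw [Real.norm_eq_abs, Real.norm_eq_abs, abs_div, abs_of_nonneg h3,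
        ← mul_div_assoc] at h
      rwa [mul_div_cancel₀ _ two_ne_zero])
    h0
  refine ⟨L, hL, IsBigO.of_bound (C / 2) ?_⟩
  filter_upwards [eventually_le_atBot T] with τ hτ
  rw [Real.norm_eq_abs, Real.norm_eq_abs, abs_div, abs_of_nonneg (sq_nonneg τ),
    ← mul_div_assoc]
  refine (hb τ hτ).trans (le_of_eq ?_)
  ring

/-! ### Energy, its correction and its limit -/

/-- The energy `ef' ^ 2 + ef ^ 4`, the fourth power of `omegaFn ef`. -/
noncomputable def bgEnergy (ef : ℝ → ℝ) (τ : ℝ) : ℝ := deriv ef τ ^ 2 + ef τ ^ 4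

/-- The energy corrected by the term that makes its derivative integrable at `-∞`. -/
noncomputable def modEnergy (ξ : ℝ) (ef : ℝ → ℝ) (τ : ℝ) : ℝ := bgEnergy ef τ - 4 / 3 * ξ * ef τ ^ 3 / (-τ)

theorem bgEnergy_nonneg (ef : ℝ → ℝ) (τ : ℝ) : 0 ≤ bgEnergy ef τ := by
  rw [bgEnergy]; positivity

theorem omegaFn_nonneg (ef : ℝ → ℝ) (τ : ℝ) : 0 ≤ omegaFn ef τ := by
  rw [omegaFn]; positivity

theorem omegaFn_pow_four (ef : ℝ → ℝ) (τ : ℝ) : omegaFn ef τ ^ 4 = bgEnergy ef τ := by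
  rw [omegaFn, ← bgEnergy, ← Real.rpow_natCast, ← Real.rpow_mul (bgEnergy_nonneg ef τ)]
  norm_num

theorem abs_le_omegaFn (ef : ℝ → ℝ) (τ : ℝ) : |ef τ| ≤ omegaFn ef τ := by
  refine le_of_pow_le_pow_left₀ four_ne_zero (omegaFn_nonneg ef τ) ?_
  rw [omegaFn_pow_four, bgEnergy, Even.pow_abs (by decide)]
  nlinarith [sq_nonneg (deriv ef τ)]

theorem abs_deriv_le_omegaFn_sq (ef : ℝ → ℝ) (τ : ℝ) : |deriv ef τ| ≤ omegaFn ef τ ^ 2 := by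
  refine le_of_pow_le_pow_left₀ two_ne_zero (by positivity) ?_
  rw [← pow_mul, omegaFn_pow_four, bgEnergy, sq_abs]
  nlinarith [sq_nonneg (ef τ ^ 2)]

section

variable {ξ : ℝ} {ef : ℝ → ℝ}

theorem IsBackgroundSolution.hasDerivAt (hef : IsBackgroundSolution ξ ef) {τ : ℝ} (hτ : τ < 0) :
    HasDerivAt ef (deriv ef τ) τ := (hef τ hτ).1.hasDerivAt

theorem IsBackgroundSolution.hasDerivAt_deriv (hef : IsBackgroundSolution ξ ef) {τ : ℝ}
    (hτ : τ < 0) : HasDerivAt (deriv ef) (2 * ξ / (-τ) * ef τ ^ 2 - 2 * ef τ ^ 3) τ :=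
  (hef τ hτ).2.1.hasDerivAt.congr_deriv (by linarith [(hef τ hτ).2.2])

theorem IsBackgroundSolution.hasDerivAt_bgEnergy (hef : IsBackgroundSolution ξ ef) {τ : ℝ}
    (hτ : τ < 0) : HasDerivAt (bgEnergy ef) (4 * ξ / (-τ) * (deriv ef τ * ef τ ^ 2)) τ := by
  refine (((hef.hasDerivAt_deriv hτ).pow 2).add ((hef.hasDerivAt hτ).pow 4)).congr_deriv ?_
  simp
  ring

theorem IsBackgroundSolution.hasDerivAt_modEnergy (hef : IsBackgroundSolution ξ ef) {τ : ℝ}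
    (hτ : τ < 0) : HasDerivAt (modEnergy ξ ef) (-(4 / 3 * ξ * ef τ ^ 3 / τ ^ 2)) τ := by
  refine ((hef.hasDerivAt_bgEnergy hτ).sub ((((hef.hasDerivAt hτ).pow 3).const_mul
    (4 / 3 * ξ)).div (hasDerivAt_id τ).neg (by simpa using hτ.ne))).congr_deriv ?_
  have := hτ.ne
  simp
  field_simp
  ring

theorem abs_cube_le_one_add_bgEnergy (ef : ℝ → ℝ) (τ : ℝ) : |ef τ ^ 3| ≤ 1 + bgEnergy ef τ := by
  have h : 0 ≤ deriv ef τ ^ 2 := sq_nonneg _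
  rw [bgEnergy, abs_le]
  constructor <;>
    nlinarith [sq_nonneg (ef τ ^ 2 - 1), sq_nonneg (ef τ ^ 2 + ef τ), sq_nonneg (ef τ ^ 2 - ef τ),
      sq_nonneg (ef τ)]

/-- Gronwall backwards in time: `H' ≥ -(8/3 ξ / τ ^ 2) (H + 1)`, and the integrating factor stays
bounded since `1 / τ ^ 2` is integrable. -/
theorem IsBackgroundSolution.bgEnergy_bounded (hef : IsBackgroundSolution ξ ef) (hξ : 0 ≤ ξ) :
    ∃ B, ∀ᶠ τ in atBot, bgEnergy ef τ ≤ B := by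
  -- Chosen so that `4/3 ξ ≤ -τ / 2` for `τ ≤ T`: the correction then takes at most half of `1 + E`.
  set T : ℝ := -(1 + 8 / 3 * ξ) with hT
  have hneg : ∀ τ ≤ T, τ < 0 := fun τ hτ => by linarith
  have hE : ∀ τ ≤ T, bgEnergy ef τ ≤ 2 * (modEnergy ξ ef τ + 1) - 1 := fun τ hτ => by
    have h3 := abs_cube_le_one_add_bgEnergy ef τ
    have ht := hneg τ hτ
    have h4 : 4 / 3 * ξ * ef τ ^ 3 / (-τ) ≤ 1 / 2 * (1 + bgEnergy ef τ) := by
      rw [div_le_iff₀ (by linarith)]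
      have h5 := mul_le_mul_of_nonneg_left ((le_abs_self _).trans h3)
        (by positivity : 0 ≤ 4 / 3 * ξ)
      have h6 : 4 / 3 * ξ ≤ 1 / 2 * (-τ) := by linarith
      have h7 := mul_le_mul_of_nonneg_right h6
        (by linarith [bgEnergy_nonneg ef τ] : 0 ≤ 1 + bgEnergy ef τ)
      linarith
    rw [modEnergy]
    linarith
  have hmono : MonotoneOn
      (fun τ => (modEnergy ξ ef τ + 1) * Real.exp (8 / 3 * ξ / (-τ))) (Iic T) := by
    refine monotoneOn_Iic_of_hasDerivAt_nonneg (fun τ hτ =>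
      ((hef.hasDerivAt_modEnergy (hneg τ hτ)).add_const 1).mul
        (hasDerivAt_const_div_neg (8 / 3 * ξ) (hneg τ hτ)).exp) fun τ hτ => ?_
    have h3 := (le_abs_self _).trans (abs_cube_le_one_add_bgEnergy ef τ)
    have h5 : 4 / 3 * ξ * ef τ ^ 3 ≤ 8 / 3 * ξ * (modEnergy ξ ef τ + 1) := by
      have := mul_le_mul_of_nonneg_left (h3.trans (by linarith [hE τ hτ] :
        _ ≤ 2 * (modEnergy ξ ef τ + 1))) (by positivity : 0 ≤ 4 / 3 * ξ)
      linarith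
    have h6 := div_le_div_of_nonneg_right h5 (sq_nonneg τ)
    have h7 := mul_nonneg (sub_nonneg.2 h6) (Real.exp_pos (8 / 3 * ξ / (-τ))).le
    refine h7.trans (le_of_eq ?_)
    ring
  refine ⟨2 * ((modEnergy ξ ef T + 1) * Real.exp (8 / 3 * ξ / (-T))), ?_⟩
  filter_upwards [eventually_le_atBot T] with τ hτ
  have h1 := hmono hτ (mem_Iic.2 le_rfl) hτ
  have h2 : 1 ≤ Real.exp (8 / 3 * ξ / (-τ)) :=
    Real.one_le_exp (div_nonneg (by positivity) (by linarith [hneg τ hτ]))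
  have h3 := hE τ hτ
  have h4 : 0 ≤ modEnergy ξ ef τ + 1 := by linarith [bgEnergy_nonneg ef τ]
  have h5 := le_mul_of_one_le_right h4 h2
  simp only at h1
  linarith

theorem IsBackgroundSolution.omegaFn_bounded (hef : IsBackgroundSolution ξ ef) (hξ : 0 ≤ ξ) :
    ∃ B, 1 ≤ B ∧ ∀ᶠ τ in atBot, omegaFn ef τ ≤ B := by
  obtain ⟨B, hB⟩ := hef.bgEnergy_bounded hξ
  refine ⟨max 1 B, le_max_left _ _, ?_⟩
  filter_upwards [hB] with τ h
  have h1 : 1 ≤ max 1 B := le_max_left _ _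
  refine le_of_pow_le_pow_left₀ four_ne_zero (by positivity) ?_
  rw [omegaFn_pow_four]
  exact (h.trans (le_max_right 1 B)).trans (le_self_pow₀ h1 four_ne_zero)

theorem IsBackgroundSolution.isBigO_one (hef : IsBackgroundSolution ξ ef) (hξ : 0 ≤ ξ) :
    ef =O[atBot] fun _ => (1 : ℝ) := by
  obtain ⟨B, -, hB⟩ := hef.omegaFn_bounded hξ
  refine IsBigO.of_bound B ?_
  filter_upwards [hB] with τ h
  simpa using (abs_le_omegaFn ef τ).trans h

theorem IsBackgroundSolution.deriv_isBigO_one (hef : IsBackgroundSolution ξ ef) (hξ : 0 ≤ ξ) :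
    deriv ef =O[atBot] fun _ => (1 : ℝ) := by
  obtain ⟨B, -, hB⟩ := hef.omegaFn_bounded hξ
  refine IsBigO.of_bound (B ^ 2) ?_
  filter_upwards [hB] with τ h
  simpa using (abs_deriv_le_omegaFn_sq ef τ).trans (pow_le_pow_left₀ (omegaFn_nonneg ef τ) h 2)

theorem IsBackgroundSolution.cube_term_isBigO (hef : IsBackgroundSolution ξ ef) (hξ : 0 ≤ ξ) :
    (fun τ => 4 / 3 * ξ * ef τ ^ 3 / (-τ)) =O[atBot] fun τ => ξ / (-τ) := by
  have h := ((hef.isBigO_one hξ).pow 3).const_mul_left (4 / 3)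
  refine (h.mul (isBigO_refl (fun τ : ℝ => ξ / (-τ)) atBot)).congr (fun τ => ?_) (fun τ => ?_)
  · ring
  · ring

theorem IsBackgroundSolution.exists_tendsto_energy (hef : IsBackgroundSolution ξ ef)
    (hξ : 0 ≤ ξ) : ∃ W, Tendsto (bgEnergy ef) atBot (𝓝 W) ∧
      Tendsto (modEnergy ξ ef) atBot (𝓝 W) ∧
      (fun τ => bgEnergy ef τ - W) =O[atBot] fun τ => ξ / (-τ) := by
  have hO : (fun τ => -(4 / 3 * ξ * ef τ ^ 3 / τ ^ 2)) =O[atBot] fun τ => ξ / τ ^ 2 := by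
    have h := ((hef.isBigO_one hξ).pow 3).const_mul_left (-(4 / 3))
    refine (h.mul (isBigO_refl (fun τ : ℝ => ξ / τ ^ 2) atBot)).congr (fun τ => ?_) (fun τ => ?_)
    · ring
    · ring
  obtain ⟨W, hW, hWO⟩ := exists_isBigO_of_deriv_isBigO_sq
    ((eventually_lt_atBot 0).mono fun τ hτ => hef.hasDerivAt_modEnergy hτ) hO
  have hEO : (fun τ => bgEnergy ef τ - W) =O[atBot] fun τ => ξ / (-τ) :=
    (hWO.add (hef.cube_term_isBigO hξ)).congr_left fun τ => by rw [modEnergy]; ring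
  refine ⟨W, ?_, hW, hEO⟩
  have h := (hEO.trans_tendsto (tendsto_const_div_neg_atBot ξ)).add_const W
  simpa using h

/-! ### Decay when the limiting energy vanishes -/

theorem abs_cube_le_omegaFn_cube (ef : ℝ → ℝ) (τ : ℝ) : |ef τ ^ 3| ≤ omegaFn ef τ ^ 3 := by
  rw [abs_pow]
  exact pow_le_pow_left₀ (abs_nonneg _) (abs_le_omegaFn ef τ) 3

/-- A solution whose energy vanishes at `-∞` decays like `1 / (-τ)`. -/
theorem IsBackgroundSolution.omegaFn_le_of_tendsto_zero (hef : IsBackgroundSolution ξ ef)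
    (hξ : 0 ≤ ξ) (h0 : Tendsto (modEnergy ξ ef) atBot (𝓝 0)) :
    ∀ᶠ τ in atBot, omegaFn ef τ ≤ 8 / 3 * ξ / (-τ) := by
  obtain ⟨B, -, hB⟩ := hef.omegaFn_bounded hξ
  obtain ⟨T, hT⟩ := eventually_atBot.1 (hB.and (eventually_lt_atBot 0))
  filter_upwards [eventually_le_atBot T] with τ hτ
  have hτ0 := (hT τ hτ).2
  -- With `M` the supremum over all earlier times, the estimates below close into `M ^ 4 ≤ q M ^ 3`
  -- with `q = 8/3 ξ / (-τ)`, hence `M ≤ q`.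
  set M := sSup (omegaFn ef '' Iic τ) with hM
  have hbdd : BddAbove (omegaFn ef '' Iic τ) := by
    refine ⟨B, ?_⟩
    rintro _ ⟨s, hs, rfl⟩
    exact (hT s (le_trans hs hτ)).1
  have hle : ∀ s ≤ τ, omegaFn ef s ≤ M := fun s hs => le_csSup hbdd ⟨s, hs, rfl⟩
  have hM0 : 0 ≤ M := (omegaFn_nonneg ef τ).trans (hle τ le_rfl)
  have hcube : ∀ s ≤ τ, |4 / 3 * ξ * ef s ^ 3| ≤ 4 / 3 * ξ * M ^ 3 := fun s hs => by
    rw [abs_mul, abs_of_nonneg (by positivity : 0 ≤ 4 / 3 * ξ)]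
    exact mul_le_mul_of_nonneg_left ((abs_cube_le_omegaFn_cube ef s).trans
      (pow_le_pow_left₀ (omegaFn_nonneg ef s) (hle s hs) 3)) (by positivity)
  obtain ⟨L, hL, hb⟩ := exists_tendsto_of_abs_deriv_le (T := τ)
    (fun s hs => hef.hasDerivAt_modEnergy (hs.trans_lt hτ0))
    (fun s hs => hasDerivAt_const_div_neg (4 / 3 * ξ * M ^ 3) (hs.trans_lt hτ0))
    (fun s hs => by
      rw [abs_neg, abs_div, abs_of_nonneg (sq_nonneg s)]
      exact div_le_div_of_nonneg_right (hcube s hs) (sq_nonneg s))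
    (tendsto_const_div_neg_atBot _)
  obtain rfl : L = 0 := tendsto_nhds_unique hL h0
  -- The `8/3` is `4/3` from integrating `H'` plus `4/3` from `E - H`.
  have hpow : ∀ s ≤ τ, omegaFn ef s ^ 4 ≤ 8 / 3 * ξ / (-τ) * M ^ 3 := fun s hs => by
    have hs0 : 0 < -s := by linarith
    have h1 := (le_abs_self _).trans (hb s hs)
    have h2 := div_le_div_of_nonneg_right ((le_abs_self _).trans (hcube s hs)) hs0.le
    rw [sub_zero, modEnergy] at h1
    have h3 : 8 / 3 * ξ * M ^ 3 / (-s) ≤ 8 / 3 * ξ * M ^ 3 / (-τ) :=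
      div_le_div_of_nonneg_left (by positivity) (by linarith) (by linarith)
    rw [omegaFn_pow_four]
    calc bgEnergy ef s ≤ 8 / 3 * ξ * M ^ 3 / (-s) := by
          rw [show 8 / 3 * ξ * M ^ 3 / (-s)
            = 4 / 3 * ξ * M ^ 3 / (-s) + 4 / 3 * ξ * M ^ 3 / (-s) by ring]
          linarith
      _ ≤ _ := h3
      _ = _ := by ring
  have hq : 0 ≤ 8 / 3 * ξ / (-τ) := div_nonneg (by positivity) (by linarith)
  have hMM : M ^ 4 ≤ 8 / 3 * ξ / (-τ) * M ^ 3 := by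
    by_contra hlt
    push Not at hlt
    have hMle : M ≤ (8 / 3 * ξ / (-τ) * M ^ 3) ^ (1 / 4 : ℝ) := by
      refine csSup_le ⟨_, τ, mem_Iic.2 le_rfl, rfl⟩ ?_
      rintro _ ⟨s, hs, rfl⟩
      rw [← Real.rpow_le_rpow_iff (z := 4) (omegaFn_nonneg ef s) (by positivity) (by norm_num),
        ← Real.rpow_mul (by positivity)]
      norm_num
      exact_mod_cast hpow s hs
    have := pow_le_pow_left₀ hM0 hMle 4
    rw [← Real.rpow_natCast (_ ^ (1 / 4 : ℝ)), ← Real.rpow_mul (by positivity)] at this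
    norm_num at this
    linarith
  refine (hle τ le_rfl).trans ?_
  rcases hM0.eq_or_lt with h | h
  · rw [← h]; exact hq
  · refine le_of_mul_le_mul_right ?_ (pow_pos h 3)
    linarith

end

section

variable {ξ : ℝ} {ef : ℝ → ℝ}

/-! ### Criteria for a positive limit -/

theorem tendsto_omegaFn {W : ℝ} (h : Tendsto (bgEnergy ef) atBot (𝓝 W)) :
    Tendsto (omegaFn ef) atBot (𝓝 (W ^ (1 / 4 : ℝ))) :=
  h.rpow_const (Or.inr (by norm_num))

/-- Since `(τ H)' = E ≥ 0`, `-τ H` stays above its positive value at `τ₁` as `τ → -∞`. A vanishing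
limit would give `-τ H ≤ 4 ξ r ^ 3 → 0` with `r = omegaFn ef`. -/
theorem IsBackgroundSolution.not_tendsto_zero_of_modEnergy_pos
    (hef : IsBackgroundSolution ξ ef) (hξ : 0 ≤ ξ) {τ₁ : ℝ} (hτ₁ : τ₁ < 0)
    (hpos : 0 < modEnergy ξ ef τ₁) (hE : Tendsto (bgEnergy ef) atBot (𝓝 0))
    (hH : Tendsto (modEnergy ξ ef) atBot (𝓝 0)) : False := by
  have hmono : MonotoneOn (fun τ => τ * modEnergy ξ ef τ) (Iic τ₁) := by
    refine monotoneOn_Iic_of_hasDerivAt_nonneg (f' := bgEnergy ef) (fun τ hτ => ?_)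
      fun τ _ => bgEnergy_nonneg ef τ
    have hτ0 : τ < 0 := hτ.trans_lt hτ₁
    refine ((hasDerivAt_id τ).mul (hef.hasDerivAt_modEnergy hτ0)).congr_deriv ?_
    rw [modEnergy]
    have := hτ0.ne
    simp
    field_simp
    ring
  have hr : Tendsto (fun τ => (8 / 3 * ξ + 4 / 3 * ξ) * omegaFn ef τ ^ 3) atBot (𝓝 0) := by
    have h := ((tendsto_omegaFn hE).pow 3).const_mul (8 / 3 * ξ + 4 / 3 * ξ)
    simpa [Real.zero_rpow] using h
  have ha : 0 < -τ₁ * modEnergy ξ ef τ₁ := mul_pos (neg_pos.2 hτ₁) hpos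
  obtain ⟨τ, h1, h2, hτ⟩ := ((hr.eventually_lt_const ha).and
    ((hef.omegaFn_le_of_tendsto_zero hξ hH).and (eventually_le_atBot τ₁))).exists
  have hτ0 : 0 < -τ := by linarith
  have h3 := hmono hτ (mem_Iic.2 le_rfl) hτ
  have h4 := (abs_le.1 (abs_cube_le_omegaFn_cube ef τ)).1
  have h5 : -τ * modEnergy ξ ef τ = -τ * omegaFn ef τ ^ 4 - 4 / 3 * ξ * ef τ ^ 3 := by
    rw [modEnergy, omegaFn_pow_four]
    have := (neg_pos.1 hτ0).ne
    field_simp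
    ring
  rw [le_div_iff₀ hτ0] at h2
  have h6 := mul_le_mul_of_nonneg_right h2 (pow_nonneg (omegaFn_nonneg ef τ) 3)
  have h7 := mul_le_mul_of_nonneg_left h4 (by positivity : 0 ≤ 4 / 3 * ξ)
  simp only at h3
  linarith

/-- From `ef' ef ^ 2 ≤ E / 2`, the quantity `τ ^ 4 E` grows backwards in time whenever `ξ < 2`,
whereas decay like `1 / (-τ)` would keep it below `(8/3 ξ) ^ 4`. -/
theorem IsBackgroundSolution.not_tendsto_zero_of_lt_two
    (hef : IsBackgroundSolution ξ ef) (hξ : 0 ≤ ξ) (hξ2 : ξ < 2) {τ₁ : ℝ} (hτ₁ : τ₁ < 0)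
    (hpos : 0 < bgEnergy ef τ₁) (hH : Tendsto (modEnergy ξ ef) atBot (𝓝 0)) : False := by
  have hQ : ∀ τ < 0, HasDerivAt (fun τ => τ ^ 4 * bgEnergy ef τ)
      (4 * τ ^ 3 * (bgEnergy ef τ - ξ * (deriv ef τ * ef τ ^ 2))) τ := fun τ hτ => by
    refine (((hasDerivAt_id τ).pow 4).mul (hef.hasDerivAt_bgEnergy hτ)).congr_deriv ?_
    have := hτ.ne
    simp
    field_simp
    ring
  have hlow : ∀ τ, (2 - ξ) / 2 * bgEnergy ef τ ≤ bgEnergy ef τ - ξ * (deriv ef τ * ef τ ^ 2) :=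
    fun τ => by
      have : deriv ef τ * ef τ ^ 2 ≤ bgEnergy ef τ / 2 := by
        rw [bgEnergy]
        nlinarith [sq_nonneg (deriv ef τ - ef τ ^ 2)]
      nlinarith
  set a := τ₁ ^ 4 * bgEnergy ef τ₁ with ha
  have ha0 : 0 < a := mul_pos (by have := hτ₁.ne; positivity) hpos
  have hcube : ∀ τ < 0, (0 : ℝ) ≤ -(4 * τ ^ 3) := fun τ hτ => by
    nlinarith [pow_pos (neg_pos.2 hτ) 3]
  have hmono : MonotoneOn (fun τ => -(τ ^ 4 * bgEnergy ef τ)) (Iic τ₁) :=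
    monotoneOn_Iic_of_hasDerivAt_nonneg (fun τ hτ => (hQ τ (hτ.trans_lt hτ₁)).neg)
      fun τ hτ => by
        have h1 := mul_nonneg (hcube τ (hτ.trans_lt hτ₁)) ((mul_nonneg
          (by linarith : 0 ≤ (2 - ξ) / 2) (bgEnergy_nonneg ef τ)).trans (hlow τ))
        linarith
  have hge : ∀ τ ≤ τ₁, a ≤ τ ^ 4 * bgEnergy ef τ := fun τ hτ => by
    have := hmono hτ (mem_Iic.2 le_rfl) hτ
    simp only at this
    linarith
  -- Feeding the lower bound `a` back into the derivative of `τ ^ 4 E` yields growth at least like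
  -- `2 (2 - ξ) a log (-τ)`.
  have hmono2 : MonotoneOn
      (fun τ => 2 * (2 - ξ) * a * Real.log (-τ) - τ ^ 4 * bgEnergy ef τ) (Iic τ₁) := by
    refine monotoneOn_Iic_of_hasDerivAt_nonneg (fun τ hτ =>
      (((hasDerivAt_neg τ).log (by linarith)).const_mul (2 * (2 - ξ) * a)).sub
        (hQ τ (hτ.trans_lt hτ₁))) fun τ hτ => ?_
    have hτ0 : τ < 0 := hτ.trans_lt hτ₁
    have h1 := mul_le_mul_of_nonneg_left (hlow τ) (hcube τ hτ0)
    have h2 := mul_le_mul_of_nonneg_left (hge τ hτ)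
      (div_nonneg (by linarith : 0 ≤ 2 * (2 - ξ)) (neg_nonneg.2 hτ0.le))
    have h3 : 2 * (2 - ξ) / (-τ) * (τ ^ 4 * bgEnergy ef τ)
        = -(4 * τ ^ 3) * ((2 - ξ) / 2 * bgEnergy ef τ) := by
      have := hτ0.ne
      field_simp
      ring
    have h4 : 2 * (2 - ξ) * a * (-1 / -τ) = -(2 * (2 - ξ) / (-τ) * a) := by ring
    rw [h4]
    linarith
  have hlog : Tendsto (fun τ => 2 * (2 - ξ) * a * Real.log (-τ)) atBot atTop :=
    (Real.tendsto_log_atTop.comp tendsto_neg_atBot_atTop).const_mul_atTop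
      (mul_pos (by linarith) ha0)
  obtain ⟨τ, h1, h2, hτ⟩ := ((hlog.eventually_gt_atTop
    ((8 / 3 * ξ) ^ 4 + (2 * (2 - ξ) * a * Real.log (-τ₁) - a))).and
      ((hef.omegaFn_le_of_tendsto_zero hξ hH).and (eventually_le_atBot τ₁))).exists
  have h3 := hmono2 hτ (mem_Iic.2 le_rfl) hτ
  rw [le_div_iff₀ (by linarith)] at h2
  have h4 := pow_le_pow_left₀ (mul_nonneg (omegaFn_nonneg ef τ) (by linarith)) h2 4
  rw [mul_pow, omegaFn_pow_four, Even.neg_pow (by decide)] at h4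
  simp only at h3
  linarith

/-! ### Second-order energy expansion -/

theorem xi_div_isBigO (hξ : 0 ≤ ξ) (f : ℝ → ℝ) (l : Filter ℝ) :
    (fun τ => ξ / f τ) =O[l] fun τ => (ξ + ξ ^ 2) / f τ := by
  refine IsBigO.of_bound 1 (Eventually.of_forall fun τ => ?_)
  rw [norm_div, norm_div, one_mul, Real.norm_of_nonneg hξ,
    Real.norm_of_nonneg (by positivity : 0 ≤ ξ + ξ ^ 2)]
  exact div_le_div_of_nonneg_right (by nlinarith) (norm_nonneg _)

theorem xi_sq_div_isBigO (hξ : 0 ≤ ξ) (f : ℝ → ℝ) (l : Filter ℝ) :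
    (fun τ => ξ ^ 2 / f τ) =O[l] fun τ => (ξ + ξ ^ 2) / f τ := by
  refine IsBigO.of_bound 1 (Eventually.of_forall fun τ => ?_)
  rw [norm_div, norm_div, one_mul, Real.norm_of_nonneg (sq_nonneg ξ),
    Real.norm_of_nonneg (by positivity : 0 ≤ ξ + ξ ^ 2)]
  exact div_le_div_of_nonneg_right (by nlinarith) (norm_nonneg _)

/-- Second-order expansion of the energy at `-∞`. -/
theorem IsBackgroundSolution.modEnergy_sub_isBigO (hef : IsBackgroundSolution ξ ef)
    (hξ : 0 ≤ ξ) {W : ℝ} (hW : Tendsto (modEnergy ξ ef) atBot (𝓝 W)) :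
    (fun τ => modEnergy ξ ef τ - W) =O[atBot] fun τ => (ξ + ξ ^ 2) / τ ^ 2 := by
  -- Substituting `2 ef ^ 3 = 2 ξ ef ^ 2 / (-τ) - ef''` in `H'` leaves `2/3 ξ ef'' / τ ^ 2`; the
  -- subtracted term integrates this by parts, and the rest is cubic in `1 / (-τ)`.
  have hd : ∀ᶠ τ in atBot, HasDerivAt
      (fun τ => modEnergy ξ ef τ - 2 / 3 * ξ / τ ^ 2 * deriv ef τ)
      (-(4 / 3 * (ξ ^ 2 * ef τ ^ 2 + ξ * deriv ef τ) / (-τ) ^ 3)) τ := by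
    filter_upwards [eventually_lt_atBot 0] with τ hτ
    refine ((hef.hasDerivAt_modEnergy hτ).sub ((hasDerivAt_const_div_sq (2 / 3 * ξ) hτ).mul
      (hef.hasDerivAt_deriv hτ))).congr_deriv ?_
    have := hτ.ne
    field_simp
    ring
  have he := hef.isBigO_one hξ
  have he' := hef.deriv_isBigO_one hξ
  have hO : (fun τ => -(4 / 3 * (ξ ^ 2 * ef τ ^ 2 + ξ * deriv ef τ) / (-τ) ^ 3)) =O[atBot]
      fun τ => (ξ + ξ ^ 2) / (-τ) ^ 3 := by
    have h1 := ((he.pow 2).mul (xi_sq_div_isBigO hξ (fun τ => (-τ) ^ 3) atBot)).add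
      ((he'.mul (xi_div_isBigO hξ (fun τ => (-τ) ^ 3) atBot)).congr_right
        (g₂ := fun τ => 1 ^ 2 * ((ξ + ξ ^ 2) / (-τ) ^ 3)) fun τ => by ring)
    refine (h1.const_mul_left (-(4 / 3))).congr (fun τ => ?_) fun τ => ?_ <;> ring
  have hcorr : (fun τ => 2 / 3 * ξ / τ ^ 2 * deriv ef τ) =O[atBot]
      fun τ => (ξ + ξ ^ 2) / τ ^ 2 := by
    refine ((he'.mul (xi_div_isBigO hξ (fun τ => τ ^ 2) atBot)).const_mul_left (2 / 3)).congr
      (fun τ => ?_) fun τ => ?_ <;> ring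
  have hz : Tendsto (fun τ : ℝ => (ξ + ξ ^ 2) / τ ^ 2) atBot (𝓝 0) :=
    (((tendsto_pow_atTop two_ne_zero).comp
      tendsto_neg_atBot_atTop).const_div_atTop (ξ + ξ ^ 2)).congr fun τ => by simp
  obtain ⟨L, hL, hLO⟩ := exists_isBigO_of_deriv_isBigO_cube hd hO
  obtain rfl : L = W := by
    refine tendsto_nhds_unique hL ?_
    simpa using hW.sub (hcorr.trans_tendsto hz)
  exact (hLO.add hcorr).congr_left fun τ => by ring

/-! ### Amplitude and phase asymptotics -/

theorem omegaFn_sub_isBigO {W ω : ℝ} (hω : 0 < ω) (hωW : ω ^ 4 = W)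
    {φ : ℝ → ℝ} (hE : (fun τ => bgEnergy ef τ - W) =O[atBot] φ) :
    (fun τ => omegaFn ef τ - ω) =O[atBot] φ := by
  refine IsBigO.trans (IsBigO.of_bound ((ω ^ 3)⁻¹) (Eventually.of_forall fun τ => ?_)) hE
  have hr := omegaFn_nonneg ef τ
  rw [← omegaFn_pow_four, ← hωW, Real.norm_eq_abs, Real.norm_eq_abs, ← div_eq_inv_mul,
    le_div_iff₀ (by positivity),
    show omegaFn ef τ ^ 4 - ω ^ 4 = (omegaFn ef τ - ω) *
      (omegaFn ef τ ^ 3 + omegaFn ef τ ^ 2 * ω + omegaFn ef τ * ω ^ 2 + ω ^ 3) by ring, abs_mul]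
  refine mul_le_mul_of_nonneg_left ?_ (abs_nonneg _)
  rw [abs_of_nonneg (by positivity)]
  have : 0 ≤ omegaFn ef τ ^ 3 + omegaFn ef τ ^ 2 * ω + omegaFn ef τ * ω ^ 2 := by positivity
  linarith

theorem IsBackgroundSolution.hasDerivAt_omegaFn (hef : IsBackgroundSolution ξ ef) {τ : ℝ}
    (hτ : τ < 0) (hr : 0 < omegaFn ef τ) :
    HasDerivAt (omegaFn ef) (ξ / (-τ) * (deriv ef τ * ef τ ^ 2) / omegaFn ef τ ^ 3) τ := by
  have hE : bgEnergy ef τ ≠ 0 := by rw [← omegaFn_pow_four]; positivity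
  have h := (hef.hasDerivAt_bgEnergy hτ).rpow_const (p := 1 / 4) (Or.inl hE)
  refine HasDerivAt.congr_deriv (f := omegaFn ef) h ?_
  rw [Real.rpow_sub_one hE]
  have h2 : bgEnergy ef τ ^ (1 / 4 : ℝ) = omegaFn ef τ := rfl
  rw [h2, ← omegaFn_pow_four]
  field_simp

/-- Rescaling to `(ef / r, ef' / r ^ 2)`, with `r = omegaFn ef`, puts the solution on the curve `x ^
4 + y ^ 2 = 1`; the equation for `r` absorbs the radial part of the forcing. -/
theorem IsBackgroundSolution.exists_phase (hef : IsBackgroundSolution ξ ef) {T : ℝ}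
    (hT : T < 0) (hr : ∀ τ ≤ T, 0 < omegaFn ef τ) :
    ∃ θ : ℝ → ℝ, ∀ τ ≤ T,
      HasDerivAt θ (omegaFn ef τ - ξ / (-τ) * (ef τ / omegaFn ef τ) ^ 3) τ ∧
      ef τ = omegaFn ef τ * jacobiSn (θ τ) := by
  have hcr : ContinuousOn (omegaFn ef) (Iic T) := fun τ hτ =>
    (hef.hasDerivAt_omegaFn (lt_of_le_of_lt hτ hT) (hr τ hτ)).continuousAt.continuousWithinAt
  have hce : ContinuousOn ef (Iic T) := fun τ hτ =>
    (hef.hasDerivAt (lt_of_le_of_lt hτ hT)).continuousAt.continuousWithinAt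
  obtain ⟨θ, hθ⟩ := exists_jacobiSn_phase (x := fun τ => ef τ / omegaFn ef τ)
    (y := fun τ => deriv ef τ / omegaFn ef τ ^ 2)
    (g := fun τ => omegaFn ef τ - ξ / (-τ) * (ef τ / omegaFn ef τ) ^ 3) (T := T)
    (by
      refine hcr.sub (ContinuousOn.mul ?_ ((hce.div hcr fun τ hτ => (hr τ hτ).ne').pow 3))
      exact continuousOn_const.div (by fun_prop) fun τ hτ => by
        have := lt_of_le_of_lt (mem_Iic.1 hτ) hT
        linarith)
    (fun τ hτ => by
      have hτ0 := hτ.trans_lt hT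
      have h := hr τ hτ
      refine ((hef.hasDerivAt hτ0).div (hef.hasDerivAt_omegaFn hτ0 h) h.ne').congr_deriv ?_
      have := hτ0.ne
      field_simp)
    (fun τ hτ => by
      have hτ0 := hτ.trans_lt hT
      have h := hr τ hτ
      refine ((hef.hasDerivAt_deriv hτ0).div ((hef.hasDerivAt_omegaFn hτ0 h).pow 2)
        (pow_ne_zero 2 h.ne')).congr_deriv ?_
      have h0 := hτ0.ne
      have h1 : deriv ef τ ^ 2 = omegaFn ef τ ^ 4 - ef τ ^ 4 := by
        rw [omegaFn_pow_four, bgEnergy]; ring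
      simp
      field_simp
      rw [h1]
      ring)
    (fun τ hτ => by
      have h := hr τ hτ
      have h1 : deriv ef τ ^ 2 = omegaFn ef τ ^ 4 - ef τ ^ 4 := by
        rw [omegaFn_pow_four, bgEnergy]; ring
      field_simp
      rw [h1]
      ring)
  refine ⟨θ, fun τ hτ => ⟨(hθ τ hτ).1, ?_⟩⟩
  rw [← (hθ τ hτ).2, mul_div_cancel₀ _ (hr τ hτ).ne']

/-- Splits the phase velocity error, after removal of a total derivative, into terms that are each
quadratically small: `r - ω` is `O(ξ / (-τ))` and `H - ω ^ 4` is already second order. -/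
theorem phase_error_identity {e e' r ω ξ τ : ℝ} (hr : r ≠ 0) (hω : ω ≠ 0) (hτ : τ ≠ 0) :
    r - ξ / (-τ) * (e / r) ^ 3 - ω - (ξ / (3 * ω ^ 3) / τ ^ 2 * e'
        + ξ / (3 * ω ^ 3) / (-τ) * (2 * ξ / (-τ) * e ^ 2 - 2 * e ^ 3))
      = 2 / 3 * (ω ^ 3)⁻¹ * e ^ 3 * (r ^ 3)⁻¹ * (r ^ 2 + r * ω + ω ^ 2)
            * (ξ / (-τ) * (r - ω))
        + (-(1 / (3 * ω ^ 3)) * e' * (ξ / τ ^ 2) + -(2 / (3 * ω ^ 3)) * e ^ 2 * (ξ ^ 2 / τ ^ 2))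
        + (1 / 4 * (r ^ 3)⁻¹ * (r ^ 4 - 4 / 3 * ξ * e ^ 3 / (-τ) - ω ^ 4)
        + 1 / 4 * (3 * r ^ 2 + 2 * r * ω + ω ^ 2) * (r ^ 3)⁻¹ * ((r - ω) * (r - ω))) := by
  field_simp
  ring

theorem IsBackgroundSolution.exists_phase_shift (hef : IsBackgroundSolution ξ ef) (hξ : 0 ≤ ξ)
    {ω : ℝ} (hω : 0 < ω) (hH : Tendsto (modEnergy ξ ef) atBot (𝓝 (ω ^ 4)))
    (hr : Tendsto (omegaFn ef) atBot (𝓝 ω))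
    (hrO : (fun τ => omegaFn ef τ - ω) =O[atBot] fun τ => ξ / (-τ))
    {θ : ℝ → ℝ} (hθ : ∀ᶠ τ in atBot,
      HasDerivAt θ (omegaFn ef τ - ξ / (-τ) * (ef τ / omegaFn ef τ) ^ 3) τ) :
    ∃ u, (fun τ => θ τ - (ω * τ + u)) =O[atBot] fun τ => (ξ + ξ ^ 2) / (-τ) := by
  have he := hef.isBigO_one hξ
  have he' := hef.deriv_isBigO_one hξ
  have hri : (fun τ => (omegaFn ef τ ^ 3)⁻¹) =O[atBot] fun _ => (1 : ℝ) :=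
    ((hr.pow 3).inv₀ (by positivity)).isBigO_one ℝ
  have hP : (fun τ => omegaFn ef τ ^ 2 + omegaFn ef τ * ω + ω ^ 2) =O[atBot] fun _ => (1 : ℝ) :=
    (((hr.pow 2).add (hr.mul_const ω)).add_const _).isBigO_one ℝ
  have hP' : (fun τ => 3 * omegaFn ef τ ^ 2 + 2 * omegaFn ef τ * ω + ω ^ 2) =O[atBot]
      fun _ => (1 : ℝ) :=
    ((((hr.pow 2).const_mul 3).add ((hr.const_mul 2).mul_const ω)).add_const _).isBigO_one ℝ
  have hsq : (fun τ : ℝ => ξ / (-τ) * (ξ / (-τ))) =O[atBot] fun τ => (ξ + ξ ^ 2) / τ ^ 2 :=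
    (xi_sq_div_isBigO hξ (fun τ => τ ^ 2) atBot).congr_left fun τ => by
      rw [div_mul_div_comm, neg_mul_neg, sq, sq]
  have hmodO := hef.modEnergy_sub_isBigO hξ hH
  have h1 : (fun τ => 2 / 3 * (ω ^ 3)⁻¹ * ef τ ^ 3 * (omegaFn ef τ ^ 3)⁻¹
      * (omegaFn ef τ ^ 2 + omegaFn ef τ * ω + ω ^ 2) * (ξ / (-τ) * (omegaFn ef τ - ω)))
      =O[atBot] fun τ => (ξ + ξ ^ 2) / τ ^ 2 := by
    have h := (((((he.pow 3).const_mul_left (2 / 3 * (ω ^ 3)⁻¹)).mul hri).mul hP).mul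
      (((isBigO_refl (fun τ : ℝ => ξ / (-τ)) atBot).mul hrO).trans hsq))
    exact h.congr_right fun τ => by ring
  have h2 : (fun τ => -(1 / (3 * ω ^ 3)) * deriv ef τ * (ξ / τ ^ 2)
      + -(2 / (3 * ω ^ 3)) * ef τ ^ 2 * (ξ ^ 2 / τ ^ 2)) =O[atBot]
      fun τ => (ξ + ξ ^ 2) / τ ^ 2 := by
    refine IsBigO.add ?_ ?_
    · exact ((he'.const_mul_left _).mul (xi_div_isBigO hξ (fun τ => τ ^ 2) atBot)).congr_right
        fun τ => by ring
    · exact (((he.pow 2).const_mul_left _).mul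
        (xi_sq_div_isBigO hξ (fun τ => τ ^ 2) atBot)).congr_right fun τ => by ring
  have h3 : (fun τ => 1 / 4 * (omegaFn ef τ ^ 3)⁻¹ * (modEnergy ξ ef τ - ω ^ 4)
      + 1 / 4 * (3 * omegaFn ef τ ^ 2 + 2 * omegaFn ef τ * ω + ω ^ 2) * (omegaFn ef τ ^ 3)⁻¹
        * ((omegaFn ef τ - ω) * (omegaFn ef τ - ω))) =O[atBot]
      fun τ => (ξ + ξ ^ 2) / τ ^ 2 := by
    refine IsBigO.add ?_ ?_
    · exact ((hri.const_mul_left _).mul hmodO).congr_right fun τ => by ring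
    · exact (((hP'.const_mul_left _).mul hri).mul ((hrO.mul hrO).trans hsq)).congr_right
        fun τ => by ring
  have hpos : ∀ᶠ τ in atBot, 0 < omegaFn ef τ := hr.eventually_const_lt hω
  -- The coefficient `1 / (3 ω ^ 3)` combines `1/3` from `r - ω` with `-1` from the forcing, giving
  -- `-2/3`, and then `ef ^ 3 ≈ -ef'' / 2`.
  obtain ⟨u, -, hu⟩ := exists_isBigO_of_deriv_isBigO_sq
    (G := fun τ => θ τ - ω * τ - ξ / (3 * ω ^ 3) / (-τ) * deriv ef τ)
    (by
      filter_upwards [hθ, hpos, eventually_lt_atBot 0] with τ hd hr0 hτ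
      refine ((hd.sub ((hasDerivAt_id τ).const_mul ω)).sub
        ((hasDerivAt_const_div_neg (ξ / (3 * ω ^ 3)) hτ).mul
          (hef.hasDerivAt_deriv hτ))).congr_deriv ?_
      rw [mul_one, phase_error_identity hr0.ne' hω.ne' hτ.ne, omegaFn_pow_four]
      rfl)
    ((h1.add h2).add h3)
  have hcorr : (fun τ => ξ / (3 * ω ^ 3) / (-τ) * deriv ef τ) =O[atBot]
      fun τ => (ξ + ξ ^ 2) / (-τ) := by
    refine ((he'.const_mul_left (1 / (3 * ω ^ 3))).mul
      (xi_div_isBigO hξ (fun τ => -τ) atBot)).congr (fun τ => ?_) fun τ => ?_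
    · field_simp
    · ring
  exact ⟨u, (hu.add hcorr).congr_left fun τ => by ring⟩

theorem IsBackgroundSolution.exists_hasOscillatoryForm (hef : IsBackgroundSolution ξ ef)
    (hξ : 0 ≤ ξ) {ω : ℝ} (hω : 0 ≤ ω) (hH : Tendsto (modEnergy ξ ef) atBot (𝓝 (ω ^ 4)))
    (hr : Tendsto (omegaFn ef) atBot (𝓝 ω))
    (hE : (fun τ => bgEnergy ef τ - ω ^ 4) =O[atBot] fun τ => ξ / (-τ)) :
    ∃ u₀, HasOscillatoryForm ξ ef ω u₀ := by
  have hK : 0 < 4 * ellipticK (-1) := by linarith [ellipticK_neg_one_pos]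
  have hξO := xi_div_isBigO hξ (fun τ => -τ) atBot
  rcases hω.eq_or_lt with rfl | hpos
  · refine ⟨0, le_rfl, ⟨le_rfl, hK⟩, ?_⟩
    refine IsBigO.trans (IsBigO.of_bound (8 / 3) ?_) hξO
    filter_upwards [hef.omegaFn_le_of_tendsto_zero hξ (by simpa using hH),
      eventually_lt_atBot 0] with τ h hτ
    rw [zero_mul, sub_zero, Real.norm_eq_abs, Real.norm_of_nonneg
      (div_nonneg hξ (by linarith)), ← mul_div_assoc]
    exact (abs_le_omegaFn ef τ).trans h
  · have hrO := omegaFn_sub_isBigO hpos rfl hE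
    obtain ⟨T, hT⟩ := eventually_atBot.1
      ((hr.eventually_const_lt hpos).and (eventually_lt_atBot 0))
    obtain ⟨θ, hθ⟩ := hef.exists_phase (hT T le_rfl).2 fun τ hτ => (hT τ hτ).1
    obtain ⟨u, hu⟩ := hef.exists_phase_shift hξ hpos hH hr hrO
      ((eventually_le_atBot T).mono fun τ hτ => (hθ τ hτ).1)
    refine ⟨toIcoMod hK 0 u, hω, by simpa using toIcoMod_mem_Ico hK 0 u, ?_⟩
    have hper : ∀ τ, jacobiSn (ω * τ + toIcoMod hK 0 u) = jacobiSn (ω * τ + u) := fun τ => by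
      rw [toIcoMod, ← add_sub_assoc, jacobiSn_periodic.sub_zsmul_eq]
    have hsn : (fun τ => jacobiSn (θ τ)) =O[atBot] fun _ => (1 : ℝ) :=
      IsBigO.of_bound 1 (Eventually.of_forall fun τ => by
        simpa using abs_jacobiSn_le_one (θ τ))
    have hdiff : (fun τ => jacobiSn (θ τ) - jacobiSn (ω * τ + u)) =O[atBot]
        fun τ => (ξ + ξ ^ 2) / (-τ) :=
      IsBigO.trans (IsBigO.of_bound 2 (Eventually.of_forall fun τ =>
        abs_jacobiSn_sub_le _ _)) hu
    have h := (((hrO.trans hξO).mul hsn).congr_right fun τ => mul_one _).add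
      (hdiff.const_mul_left ω)
    refine h.congr' ?_ EventuallyEq.rfl
    filter_upwards [eventually_le_atBot T] with τ hτ
    rw [hper, (hθ τ hτ).2]
    ring

theorem HasOscillatoryForm.tendsto_sub {ω u₀ : ℝ} (h : HasOscillatoryForm ξ ef ω u₀) :
    Tendsto (fun τ => ef τ - ω * jacobiSn (ω * τ + u₀)) atBot (𝓝 0) :=
  h.2.2.trans_tendsto (tendsto_const_div_neg_atBot _)

end

/-! ### The theorem -/

theorem mainTheorem4 (ξ : ℝ) (hξ : 0 ≤ ξ) (ef : ℝ → ℝ) (hef : IsBackgroundSolution ξ ef) :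
    ∃ ω : ℝ, Tendsto (omegaFn ef) atBot (𝓝 ω) ∧
      (∀ ω' : ℝ, (∃ u₀ : ℝ, HasOscillatoryForm ξ ef ω' u₀) ↔ ω' = ω) ∧
      ((∃ τ₁ < 0, (ξ < 2 ∧ 0 < omegaFn ef τ₁) ∨ 4 / 3 * ξ / (-τ₁) < omegaFn ef τ₁) → 0 < ω) := by
  obtain ⟨W, hE, hH, hO⟩ := hef.exists_tendsto_energy hξ
  obtain ⟨ω, hr⟩ : ∃ ω, Tendsto (omegaFn ef) atBot (𝓝 ω) := ⟨_, tendsto_omegaFn hE⟩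
  have hω : 0 ≤ ω :=
    ge_of_tendsto hr (Eventually.of_forall fun τ => omegaFn_nonneg ef τ)
  obtain rfl : ω ^ 4 = W := by
    refine tendsto_nhds_unique ((hr.pow 4).congr fun τ => omegaFn_pow_four ef τ) hE
  obtain ⟨u₀, hu₀⟩ := hef.exists_hasOscillatoryForm hξ hω hH hr hO
  refine ⟨ω, hr, fun ω' => ⟨?_, ?_⟩, ?_⟩
  · rintro ⟨u', hu'⟩
    exact le_antisymm (le_of_tendsto_sub_jacobiSn hω hu'.1 hu₀.tendsto_sub hu'.tendsto_sub)
      (le_of_tendsto_sub_jacobiSn hu'.1 hω hu'.tendsto_sub hu₀.tendsto_sub)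
  · rintro rfl
    exact ⟨u₀, hu₀⟩
  · rintro ⟨τ₁, hτ₁, h⟩
    refine hω.lt_of_ne fun h0 => ?_
    rw [← h0, zero_pow four_ne_zero] at hE hH
    rcases h with ⟨hξ2, h⟩ | h
    · exact hef.not_tendsto_zero_of_lt_two hξ hξ2 hτ₁
        (by rw [← omegaFn_pow_four]; positivity) hH
    · refine hef.not_tendsto_zero_of_modEnergy_pos hξ hτ₁ ?_ hE hH
      have hτ0 : 0 < -τ₁ := neg_pos.2 hτ₁
      have hr0 : 0 < omegaFn ef τ₁ := lt_of_le_of_lt (by positivity) h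
      -- The threshold `4/3 ξ / (-τ₁)` is what makes `r ^ 4` beat the correction, bounded by `4/3 ξ
      -- r ^ 3 / (-τ₁)`.
      rw [modEnergy, ← omegaFn_pow_four, sub_pos]
      calc 4 / 3 * ξ * ef τ₁ ^ 3 / (-τ₁) = 4 / 3 * ξ / (-τ₁) * ef τ₁ ^ 3 := by ring
        _ ≤ 4 / 3 * ξ / (-τ₁) * omegaFn ef τ₁ ^ 3 :=
          mul_le_mul_of_nonneg_left ((le_abs_self _).trans (abs_cube_le_omegaFn_cube ef τ₁))
            (by positivity)
        _ < omegaFn ef τ₁ * omegaFn ef τ₁ ^ 3 := mul_lt_mul_of_pos_right h (by positivity)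
        _ = omegaFn ef τ₁ ^ 4 := by ring
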